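/- Let $d\ge 1$ be an integer and, for $f\in L_1(\mathbb T^d)$ (functions on $\mathbb R^d$ that are $2\pi$-periodic in each variable and integrable over $[0,2\pi]^d$), let $\widehat f(\mathbf k)=(2\pi)^{-d}\int_{[0,2\pi]^d}f(\mathbf x)e^{-i(\mathbf k,\mathbf x)}\,d\mathbf x$, $\mathbf k\in\mathbb Z^d$, and $\|f\|_{S^p}=\big(\sum_{\mathbf k\in\mathbb Z^d}|\widehat f(\mathbf k)|^p\big)^{1/p}\in[0,\infty]$. For a class $\mathfrak N\subset L_1(\mathbb T^d)$ put $$e_n(\mathfrak N)_{S^p}=\sup_{f\in\mathfrak N}\ \inf_{\gamma_n,\,c_{\mathbf k}}\Big\|f-\sum_{\mathbf k\in\gamma_n}c_{\mathbf k}e^{i(\mathbf k,\cdot)}\Big\|_{S^p},$$ where $\gamma_n$ runs over the sets of $n$ distinct vectors of $\mathbb Z^d$ and the $c_{\mathbf k}$ over the complex numbers. Let $|\mathbf k|_r=\big(\sum_j|k_j|^r\big)^{1/r}$ for $r<\infty$ and $|\mathbf k|_\infty=\max_j|k_j|$. For a positive nonincreasing function $\psi$ on $[1,\infty)$, with $\psi(0):=\psi(1)$,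 let $$F^\psi_{q,r}=\Big\{f\in L_1(\mathbb T^d):\ \Big(\sum_{\mathbf k\in\mathbb Z^d}\big(|\widehat f(\mathbf k)|/\psi(|\mathbf k|_r)\big)^q\Big)^{1/q}\le 1\Big\}.$$ Let $B$ be the set of positive nonincreasing functions $\varphi$ on $[1,\infty)$ with $\lim_{t\to\infty}\varphi(t)=0$ for which there are constants $c>1$ and $K>0$ such that $1<\varphi(t)/\varphi(ct)\le K$ for all $t\ge 1$. **Corollary 4.1.** Let $1\le p<\infty$, $0<q<\infty$, and let $\psi$ be a positive nonincreasing function on $[1,\infty)$ with $\psi^p\in B$. If $p<q$, assume moreover that there are numbers $t_0$ and $K_\psi>d\left(\frac1p-\frac1q\right)$ such that $\psi^p$ is convex on $(t_0,\infty)$ and $$\frac{t\,|\psi'(t+)|}{\psi(t)}\ge K_\psi\qquad\text{for all } t>t_0,$$ where $\psi'(t+)$ is the right derivative. Then for every $r$ with $1\le r\le\infty$ $$e_n(F^\psi_{q,r})_{S^p}\asymp \psi(n^{1/d})\,n^{\frac1p-\frac1q},$$ that is, there are constants $0<K_1<K_2$ such that $K_1\,\psi(n^{1/d})\,n^{\frac1p-\frac1q}\le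 e_n(F^\psi_{q,r})_{S^p}\le K_2\,\psi(n^{1/d})\,n^{\frac1p-\frac1q}$ for all $n=1,2,\dots$ -/

import Mathlib

open Set Filter Topology MeasureTheory
open scoped ENNReal

noncomputable section

namespace TrigApprox

variable {d : ℕ}

/-- The exponential `x ↦ e^{i(k,x)}` on `ℝ^d`, for `k ∈ ℤ^d`. -/
def trigExp (k : Fin d → ℤ) (x : Fin d → ℝ) : ℂ :=
  Complex.exp (Complex.I * ((∑ j, (k j : ℝ) * x j : ℝ) : ℂ))

/-- The box `[0, 2π]^d`. -/
def torusBox (d : ℕ) : Set (Fin d → ℝ) :=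
  Set.Icc (fun _ => 0) (fun _ => 2 * Real.pi)

/-- `f ∈ L_1(𝕋^d)`: `f` is `2π`-periodic in each variable and integrable over `[0, 2π]^d`. -/
structure MemL1 (f : (Fin d → ℝ) → ℂ) : Prop where
  periodic : ∀ (j : Fin d) (x : Fin d → ℝ), f (x + Pi.single j (2 * Real.pi)) = f x
  integrableOn : IntegrableOn f (torusBox d) volume

/-- The Fourier coefficient `(2π)^{-d} ∫_{[0,2π]^d} f(x) e^{-i(k,x)} dx`. -/
def fourierCoef (f : (Fin d → ℝ) → ℂ) (k : Fin d → ℤ) : ℂ :=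
  ((2 * (Real.pi : ℂ)) ^ d)⁻¹ * ∫ x in torusBox d, f x * trigExp (-k) x

/-- The `l_p(ℤ^d)` (quasi-)norm of a family of complex numbers, `0 < p < ∞`, with values
in `[0, ∞]`. -/
def seqNorm (p : ℝ) (a : (Fin d → ℤ) → ℂ) : ℝ≥0∞ :=
  (∑' k, ‖a k‖ₑ ^ p) ^ (1 / p)

/-- The (quasi-)norm of `f` in `S^p(𝕋^d)`, with value `∞` if `f` is not in `S^p(𝕋^d)`. -/
def sNorm (p : ℝ) (f : (Fin d → ℝ) → ℂ) : ℝ≥0∞ :=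
  seqNorm p (fourierCoef f)

/-- The `l_r` (quasi-)norm `|k|_r` of `k ∈ ℤ^d`, `0 < r ≤ ∞`. -/
def vecNorm (r : ℝ≥0∞) (k : Fin d → ℤ) : ℝ :=
  ‖(WithLp.toLp r (fun j => (k j : ℝ)) : PiLp r (fun _ : Fin d => ℝ))‖

/-- A function `ψ` on `[1, ∞)`, extended to the point `0` by `ψ(0) := ψ(1)`. -/
def extendZero (ψ : ℝ → ℝ) (t : ℝ) : ℝ :=
  if t = 0 then ψ 1 else ψ t

/-- The class `F^ψ_{q,r}` of all `f ∈ L_1(𝕋^d)` such that the `l_q(ℤ^d)` (quasi-)norm of the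
family `f̂(k) / ψ(|k|_r)` is at most `1`. -/
def classF (d : ℕ) (q : ℝ) (r : ℝ≥0∞) (ψ : ℝ → ℝ) : Set ((Fin d → ℝ) → ℂ) :=
  {f | MemL1 f ∧
    seqNorm q (fun k => fourierCoef f k / (extendZero ψ (vecNorm r k) : ℂ)) ≤ 1}

/-- The best `n`-term trigonometric approximation of `f` in `S^p(𝕋^d)`. -/
def bestNTerm (p : ℝ) (n : ℕ) (f : (Fin d → ℝ) → ℂ) : ℝ≥0∞ :=
  ⨅ (γ : Finset (Fin d → ℤ)) (_ : γ.card = n) (c : (Fin d → ℤ) → ℂ),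
    sNorm p (fun x => f x - ∑ k ∈ γ, c k * trigExp k x)

/-- The best `n`-term trigonometric approximation of a class of functions in `S^p(𝕋^d)`. -/
def bestNTermClass (p : ℝ) (n : ℕ) (N : Set ((Fin d → ℝ) → ℂ)) : ℝ≥0∞ :=
  ⨆ f ∈ N, bestNTerm p n f

/-- The set `B` of positive nonincreasing functions `φ` on `[1, ∞)` that tend to `0` at infinity
and satisfy `1 < φ(t) / φ(ct) ≤ K` for all `t ≥ 1`, with some constants `c > 1` and `K > 0`. -/
def classB : Set (ℝ → ℝ) :=
  {φ | (∀ t, 1 ≤ t → 0 < φ t) ∧ AntitoneOn φ (Set.Ici 1) ∧ Tendsto φ atTop (𝓝 0) ∧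
    ∃ c > 1, ∃ K > 0, ∀ t, 1 ≤ t → 1 < φ t / φ (c * t) ∧ φ t / φ (c * t) ≤ K}

/-- `α(ψ, t) = ψ(t) / (t |ψ'(t)|)`, where `ψ'(t)` is the right derivative. If `ψ'(t) = 0`, then
`1 / α(ψ, t)` is `0`, as it should be. -/
def alphaChar (ψ : ℝ → ℝ) (t : ℝ) : ℝ :=
  ψ t / (t * |derivWithin ψ (Set.Ioi t) t|)

/-- `a(n) ≍ b(n)`: there are constants `0 < K₁ < K₂` with `K₁ b(n) ≤ a(n) ≤ K₂ b(n)` for all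
`n = 1, 2, …`. -/
def SameOrder (a : ℕ → ℝ≥0∞) (b : ℕ → ℝ) : Prop :=
  ∃ K₁ K₂ : ℝ, 0 < K₁ ∧ K₁ < K₂ ∧ ∀ n : ℕ, 1 ≤ n →
    ENNReal.ofReal (K₁ * b n) ≤ a n ∧ a n ≤ ENNReal.ofReal (K₂ * b n)

end TrigApprox

end

/-!
Only the absolute values of the Fourier coefficients enter the problem, and for a fixed set of
frequencies the best coefficients are the Fourier coefficients themselves. So `f` may be replaced
by a family `b k * ψ(|k|_r)` with `∑ b k ^ q ≤ 1`, and about `t ^ d` frequencies have size at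
most `t`.

For the upper bound, use at most `n / 2` terms to remove the frequencies of size less than a small
multiple of `n ^ (1 / d)`. If `q ≤ p`, the remaining weights are `O(ψ(n ^ (1 / d)))` by doubling,
and Stechkin's inequality for `b` gives the factor `n ^ (1 / p - 1 / q)`. If `p < q`, Hölder's
inequality bounds the error by the `ℓ_s` norm of the remaining weights, `1 / s = 1 / p - 1 / q`,
and this tail is of the order of its first dyadic shell because the condition on `ψ'` makes
`ψ(t) t ^ β` almost decreasing for some `β > d / s`.

For the lower bound, take a polynomial with `2 n` equal coefficients at frequencies of size
`O(n ^ (1 / d))`: any `n` terms leave at least half of it.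
-/

namespace TrigApprox

section NTermError

variable {ι : Type*} {p q s : ℝ} {m n : ℕ} {a b w : ι → ℝ≥0∞}

/-- The best `n`-term approximation error in `ℓ_p` of a family with absolute values `a`: the
optimal coefficients reproduce the `n` chosen terms, so that only the remaining ones count. -/
noncomputable def nTermError (p : ℝ) (n : ℕ) (a : ι → ℝ≥0∞) : ℝ≥0∞ :=
  ⨅ (γ : Finset ι) (_ : γ.card ≤ n), (∑' k : ((γ : Set ι)ᶜ : Set ι), a k ^ p) ^ (1 / p)

theorem nTermError_le {γ : Finset ι} (hγ : γ.card ≤ n) :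
    nTermError p n a ≤ (∑' k : ((γ : Set ι)ᶜ : Set ι), a k ^ p) ^ (1 / p) :=
  iInf₂_le γ hγ

theorem nTermError_le_mul (hp : 0 < p) {M : ℝ≥0∞} (hM₀ : M ≠ 0) (hM : M ≠ ∞)
    (hab : ∀ k, a k ≤ M * b k) : nTermError p n a ≤ M * nTermError p n b := by
  simp only [nTermError, ENNReal.mul_iInf_of_ne hM₀ hM]
  refine iInf₂_mono fun γ _ => ?_
  calc (∑' k : ((γ : Set ι)ᶜ : Set ι), a k ^ p) ^ (1 / p)
      ≤ (∑' k : ((γ : Set ι)ᶜ : Set ι), M ^ p * b k ^ p) ^ (1 / p) := by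
        simp only [← ENNReal.mul_rpow_of_nonneg _ _ hp.le]
        gcongr
        exact hab _
    _ = M * (∑' k : ((γ : Set ι)ᶜ : Set ι), b k ^ p) ^ (1 / p) := by
        rw [ENNReal.tsum_mul_left, ENNReal.mul_rpow_of_nonneg _ _ (by positivity),
          ← ENNReal.rpow_mul, mul_one_div_cancel hp.ne', ENNReal.rpow_one]

theorem nTermError_le_nTermError_indicator (hp : 0 < p) {A : Finset ι} (hA : A.card + m ≤ n) :
    nTermError p n a ≤ nTermError p m ((A : Set ι)ᶜ.indicator a) := by
  classical
  refine le_iInf₂ fun γ hγ => (nTermError_le (γ := A ∪ γ) ?_).trans ?_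
  · exact (Finset.card_union_le _ _).trans (by omega)
  · gcongr
    calc ∑' k : (((A ∪ γ : Finset ι) : Set ι)ᶜ : Set ι), a k ^ p
        = ∑' k : (((A ∪ γ : Finset ι) : Set ι)ᶜ : Set ι), (A : Set ι)ᶜ.indicator a k ^ p :=
          tsum_congr fun ⟨k, hk⟩ => by
            have hkA : k ∈ (A : Set ι)ᶜ := fun h => hk (Finset.mem_union_left γ h)
            simp only [indicator_of_mem hkA]
      _ ≤ ∑' k : ((γ : Set ι)ᶜ : Set ι), (A : Set ι)ᶜ.indicator a k ^ p :=
          ENNReal.tsum_mono_subtype (fun k => (A : Set ι)ᶜ.indicator a k ^ p)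
            (compl_subset_compl.2 (Finset.coe_subset.2 Finset.subset_union_right))

/-- Stechkin's inequality: `n` terms capture all `k` with `b k ^ q ≥ 1 / n`. -/
theorem nTermError_le_rpow_of_tsum_rpow_le_one (hq : 0 < q) (hqp : q ≤ p)
    (hb : ∑' k, b k ^ q ≤ 1) : nTermError p n b ≤ (n : ℝ≥0∞) ^ (1 / p - 1 / q) := by
  have hp : 0 < p := hq.trans_le hqp
  set ε : ℝ≥0∞ := (n : ℝ≥0∞)⁻¹
  obtain ⟨hfin, hcard⟩ := ENNReal.finset_card_const_le_le_of_tsum_le ENNReal.one_ne_top hb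
    (ENNReal.inv_ne_zero.2 (ENNReal.natCast_ne_top n))
  rw [one_div, inv_inv, Nat.cast_le] at hcard
  have hsmall : ∀ k : ((hfin.toFinset : Set ι)ᶜ : Set ι),
      b k ^ p ≤ ε ^ ((p - q) / q) * b k ^ q := by
    rintro ⟨k, hk⟩
    have hkε : b k ^ q ≤ ε := by simpa using (not_le.1 (by simpa using hk)).le
    calc b k ^ p = (b k ^ q) ^ ((p - q) / q) * b k ^ q := by
          rw [← ENNReal.rpow_mul, mul_div_cancel₀ _ hq.ne',
            ← ENNReal.rpow_add_of_nonneg _ _ (by linarith) hq.le, sub_add_cancel]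
      _ ≤ ε ^ ((p - q) / q) * b k ^ q := by
          gcongr ?_ * _
          exact ENNReal.rpow_le_rpow hkε (div_nonneg (sub_nonneg.2 hqp) hq.le)
  calc nTermError p n b
      ≤ (∑' k : ((hfin.toFinset : Set ι)ᶜ : Set ι), b k ^ p) ^ (1 / p) := nTermError_le hcard
    _ ≤ (∑' k : ((hfin.toFinset : Set ι)ᶜ : Set ι), ε ^ ((p - q) / q) * b k ^ q) ^ (1 / p) := by
        gcongr with k
        exact hsmall k
    _ ≤ (ε ^ ((p - q) / q)) ^ (1 / p) := by
        gcongr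
        rw [ENNReal.tsum_mul_left]
        exact mul_le_of_le_one_right' ((ENNReal.tsum_comp_le_tsum_of_injective
          Subtype.val_injective fun k => b k ^ q).trans hb)
    _ = (n : ℝ≥0∞) ^ (1 / p - 1 / q) := by
        rw [← ENNReal.rpow_mul, ENNReal.inv_rpow, ← ENNReal.rpow_neg]
        congr 1
        field_simp
        ring

theorem tsum_mul_rpow_le (hp : 0 < p) (hpq : p < q) (hpqs : 1 / p = 1 / q + 1 / s) :
    (∑' k, (b k * w k) ^ p) ^ (1 / p) ≤
      (∑' k, b k ^ q) ^ (1 / q) * (∑' k, w k ^ s) ^ (1 / s) := by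
  let : MeasurableSpace ι := ⊤
  simpa only [lintegral_count, Pi.mul_apply] using
    ENNReal.lintegral_Lp_mul_le_Lq_mul_Lr hp hpq hpqs Measure.count
      (measurable_from_top (f := b)).aemeasurable (measurable_from_top (f := w)).aemeasurable

theorem nTermError_mul_le (hp : 0 < p) (hpq : p < q) (hpqs : 1 / p = 1 / q + 1 / s)
    (hb : ∑' k, b k ^ q ≤ 1) {γ : Finset ι} (hγ : γ.card ≤ n) :
    nTermError p n (fun k => b k * w k) ≤
      (∑' k : ((γ : Set ι)ᶜ : Set ι), w k ^ s) ^ (1 / s) := by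
  have hb' : ∑' k : ((γ : Set ι)ᶜ : Set ι), b k ^ q ≤ 1 :=
    (ENNReal.tsum_comp_le_tsum_of_injective Subtype.val_injective fun k => b k ^ q).trans hb
  refine (nTermError_le hγ).trans ((tsum_mul_rpow_le hp hpq hpqs).trans ?_)
  exact mul_le_of_le_one_left' (ENNReal.rpow_le_one hb' (one_div_pos.2 (hp.trans hpq)).le)

theorem mul_le_nTermError (hp : 0 < p) {M : ℝ≥0∞} {N : Finset ι} (hM : ∀ k ∈ N, M ≤ a k) :
    ((N.card - n : ℕ) : ℝ≥0∞) ^ (1 / p) * M ≤ nTermError p n a := by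
  classical
  refine le_iInf₂ fun γ hγ => ?_
  calc ((N.card - n : ℕ) : ℝ≥0∞) ^ (1 / p) * M
      = (((N.card - n : ℕ) : ℝ≥0∞) * M ^ p) ^ (1 / p) := by
        rw [ENNReal.mul_rpow_of_nonneg _ _ (by positivity), ← ENNReal.rpow_mul,
          mul_one_div_cancel hp.ne', ENNReal.rpow_one]
    _ ≤ (∑ k ∈ N \ γ, a k ^ p) ^ (1 / p) := by
        gcongr
        rw [← nsmul_eq_mul]
        have hcard : N.card - n ≤ (N \ γ).card :=
          (Nat.sub_le_sub_left hγ _).trans (Finset.le_card_sdiff γ N)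
        refine (nsmul_le_nsmul_left zero_le hcard).trans (Finset.card_nsmul_le_sum _ _ _ ?_)
        intro k hk
        gcongr
        exact hM k (Finset.mem_sdiff.1 hk).1
    _ ≤ (∑' k : ((γ : Set ι)ᶜ : Set ι), a k ^ p) ^ (1 / p) := by
        gcongr
        rw [← Finset.tsum_subtype (N \ γ) fun k => a k ^ p]
        exact ENNReal.tsum_mono_subtype (fun k => a k ^ p)
          fun k hk => (Finset.mem_sdiff.1 hk).2

end NTermError

section Weight

variable {ψ : ℝ → ℝ} {β K p t₀ : ℝ}

/-- A positive nonincreasing weight on `[1, ∞)` with `ψ(t) ≤ K ψ(ct)` for some `c > 1`, so that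
dilations of the argument change it at most by constant factors. -/
structure IsDoublingWeight (ψ : ℝ → ℝ) : Prop where
  pos : ∀ t, 1 ≤ t → 0 < ψ t
  antitoneOn : AntitoneOn ψ (Ici 1)
  exists_le_mul : ∃ c > 1, ∃ K, ∀ t, 1 ≤ t → ψ t ≤ K * ψ (c * t)

/-- Decay of order `β` at infinity: `t ↦ ψ(t) t ^ β` is almost decreasing on `[1, ∞)`, that is,
decreasing up to a constant factor. -/
def HasPowerDecay (ψ : ℝ → ℝ) (β : ℝ) : Prop :=
  ∃ C > 0, ∀ t s, 1 ≤ t → t ≤ s → ψ s * s ^ β ≤ C * (ψ t * t ^ β)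

theorem isDoublingWeight_of_rpow_mem_classB (hp : 0 < p) (hψ_pos : ∀ t, 1 ≤ t → 0 < ψ t)
    (hψ_anti : AntitoneOn ψ (Ici 1)) (hψB : (fun t => ψ t ^ p) ∈ classB) :
    IsDoublingWeight ψ := by
  obtain ⟨-, -, -, c, hc, K, hK, hratio⟩ := hψB
  refine ⟨hψ_pos, hψ_anti, c, hc, K ^ p⁻¹, fun t ht => ?_⟩
  have hψt := hψ_pos t ht
  have hψct := hψ_pos (c * t) (by nlinarith)
  have hle : ψ t ^ p ≤ K * ψ (c * t) ^ p := (div_le_iff₀ (by positivity)).1 (hratio t ht).2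
  calc ψ t ≤ (K * ψ (c * t) ^ p) ^ p⁻¹ :=
        (Real.le_rpow_inv_iff_of_pos hψt.le (by positivity) hp).2 hle
    _ = K ^ p⁻¹ * ψ (c * t) := by
        rw [Real.mul_rpow hK.le (by positivity), Real.rpow_rpow_inv hψct.le hp.ne']

theorem IsDoublingWeight.exists_le_mul_pow (hψ : IsDoublingWeight ψ) :
    ∃ c > 1, ∃ K > 0, ∀ (j : ℕ) (t : ℝ), 1 ≤ t → ψ t ≤ K ^ j * ψ (c ^ j * t) := by
  obtain ⟨c, hc, K, hK⟩ := hψ.exists_le_mul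
  have hK0 : 0 < K := pos_of_mul_pos_left ((hψ.pos 1 le_rfl).trans_le (hK 1 le_rfl))
    (hψ.pos (c * 1) (by linarith)).le
  refine ⟨c, hc, K, hK0, fun j => ?_⟩
  induction j with
  | zero => simp
  | succ j ih =>
    intro t ht
    calc ψ t ≤ K ^ j * ψ (c ^ j * t) := ih t ht
      _ ≤ K ^ j * (K * ψ (c * (c ^ j * t))) := by
          gcongr
          exact hK _ (one_le_mul_of_one_le_of_one_le (one_le_pow₀ hc.le) ht)
      _ = K ^ (j + 1) * ψ (c ^ (j + 1) * t) := by rw [← mul_assoc c, ← pow_succ']; ring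

theorem IsDoublingWeight.exists_le_mul_of_le_mul (hψ : IsDoublingWeight ψ) (A : ℝ) :
    ∃ C > 0, ∀ t s, 1 ≤ t → 1 ≤ s → s ≤ A * t → ψ t ≤ C * ψ s := by
  obtain ⟨c, hc, K, hK, hiter⟩ := hψ.exists_le_mul_pow
  obtain ⟨j, hj⟩ := pow_unbounded_of_one_lt A hc
  refine ⟨K ^ j, by positivity, fun t s ht hs hst => (hiter j t ht).trans ?_⟩
  have hle : s ≤ c ^ j * t := hst.trans (by gcongr)
  gcongr
  exact hψ.antitoneOn hs (hs.trans hle) hle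

theorem IsDoublingWeight.exists_le_mul_rpow (hψ : IsDoublingWeight ψ) (hβ₀ : 0 ≤ β)
    (hβ : HasPowerDecay ψ β) (A : ℝ) :
    ∃ C > 0, ∀ t s, 1 ≤ t → 1 ≤ s → t ≤ A * s → ψ s ≤ C * ψ t * (1 + s / t) ^ (-β) := by
  obtain ⟨C₁, hC₁, hdecay⟩ := hβ
  obtain ⟨C₂, hC₂, hdoubling⟩ := hψ.exists_le_mul_of_le_mul A
  refine ⟨2 ^ β * max C₁ C₂, by positivity, fun t s ht hs hts => ?_⟩
  have hψt := hψ.pos t ht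
  have hψs := hψ.pos s hs
  rw [Real.rpow_neg (by positivity), ← div_eq_mul_inv, le_div_iff₀ (by positivity)]
  rcases le_total t s with hle | hle
  · calc ψ s * (1 + s / t) ^ β ≤ ψ s * (2 * (s / t)) ^ β := by
          gcongr
          linarith [(one_le_div (by linarith)).2 hle]
      _ = 2 ^ β * (ψ s * s ^ β) / t ^ β := by
          rw [Real.mul_rpow (by norm_num) (by positivity),
            Real.div_rpow (by linarith) (by linarith)]
          ring
      _ ≤ 2 ^ β * (C₁ * (ψ t * t ^ β)) / t ^ β := by
          gcongr ?_ / _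
          exact mul_le_mul_of_nonneg_left (hdecay t s ht hle) (by positivity)
      _ = 2 ^ β * C₁ * ψ t := by field_simp
      _ ≤ 2 ^ β * max C₁ C₂ * ψ t := by
          gcongr
          exact le_max_left _ _
  · calc ψ s * (1 + s / t) ^ β ≤ C₂ * ψ t * 2 ^ β := by
          gcongr
          · exact hdoubling s t hs ht hts
          · linarith [(div_le_one (by linarith)).2 hle]
      _ = 2 ^ β * C₂ * ψ t := by ring
      _ ≤ 2 ^ β * max C₁ C₂ * ψ t := by
          gcongr
          exact le_max_right _ _

theorem le_left_of_lowerSemicontinuousOn_of_frequently_le {f : ℝ → ℝ} {a b : ℝ} (hab : a ≤ b)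
    (hf : LowerSemicontinuousOn f (Icc a b))
    (hdesc : ∀ x ∈ Ico a b, ∃ᶠ y in 𝓝[>] x, f y ≤ f x) : f b ≤ f a := by
  refine IsClosed.Icc_subset_of_forall_exists_gt (s := {x | f x ≤ f a}) ?_ (le_refl (f a))
    ?_ (right_mem_Icc.2 hab)
  · obtain ⟨v, hv, hfv⟩ := lowerSemicontinuousOn_iff_preimage_Iic.1 hf (f a)
    have : {x | f x ≤ f a} ∩ Icc a b = Icc a b ∩ v := by rw [← hfv, inter_comm]; rfl
    exact this ▸ isClosed_Icc.inter hv
  · rintro x ⟨hxa, hx⟩ y hxy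
    obtain ⟨z, hzx, hz⟩ := ((hdesc x hx).and_eventually (Ioc_mem_nhdsGT hxy)).exists
    exact ⟨z, hzx.trans hxa, hz⟩

theorem lowerSemicontinuousWithinAt_mul_rpow {f : ℝ → ℝ} {S : Set ℝ} {x : ℝ} (hx : 0 < x)
    (hS : S ⊆ Ici 0) (hf : AntitoneOn f S) (hxS : x ∈ S) (hcont : ContinuousWithinAt f (Ioi x) x) :
    LowerSemicontinuousWithinAt (fun t => f t * t ^ β) S x := by
  intro y hy
  have hpow : ContinuousAt (fun t : ℝ => t ^ β) x := Real.continuousAt_rpow_const _ _ (.inl hx.ne')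
  have hleft : ∀ᶠ t in 𝓝 x, y < f x * t ^ β := (hpow.const_mul (f x)).eventually_const_lt hy
  have hright : ∀ᶠ t in 𝓝[>] x, y < f t * t ^ β :=
    (hcont.mul hpow.continuousWithinAt).eventually_const_lt hy
  filter_upwards [self_mem_nhdsWithin, nhdsWithin_le_nhds hleft,
    nhdsWithin_le_nhds (eventually_nhdsWithin_iff.1 hright)] with t htS htl htr
  rcases le_or_gt t x with htx | htx
  · have := Real.rpow_nonneg (hS htS) β
    exact htl.trans_le (by gcongr; exact hf htS hxS htx)
  · exact htr htx

theorem eventually_mul_rpow_lt_of_hasDerivWithinAt {f' t : ℝ} (ht : 0 < t)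
    (hf : HasDerivWithinAt ψ f' (Ioi t) t) (hf' : t * f' < -(β * ψ t)) :
    ∀ᶠ s in 𝓝[>] t, ψ s * s ^ β < ψ t * t ^ β := by
  have hderiv := hf.mul (Real.hasDerivAt_rpow_const (p := β) (.inl ht.ne')).hasDerivWithinAt
  have hneg : f' * t ^ β + ψ t * (β * t ^ (β - 1)) < 0 := by
    calc f' * t ^ β + ψ t * (β * t ^ (β - 1)) = t ^ (β - 1) * (t * f' + β * ψ t) := by
          rw [Real.rpow_sub_one ht.ne']
          field_simp
      _ < 0 := mul_neg_of_pos_of_neg (by positivity) (by linarith)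
  have hslope := (hasDerivWithinAt_iff_tendsto_slope' self_notMem_Ioi).1 hderiv
  filter_upwards [hslope.eventually_lt_const hneg, self_mem_nhdsWithin] with s hs hts
  exact sub_neg.1 (neg_of_smul_neg_left hs (inv_nonneg.2 (sub_nonneg.2 (le_of_lt hts))))

theorem differentiableWithinAt_of_le_one_div_alphaChar {t : ℝ} (hK : 0 < K)
    (h : K ≤ 1 / alphaChar ψ t) : DifferentiableWithinAt ℝ ψ (Ioi t) t := by
  by_contra hnd
  rw [alphaChar, derivWithin_zero_of_not_differentiableWithinAt hnd, abs_zero, mul_zero, div_zero,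
    div_zero] at h
  exact hK.not_ge h

theorem mul_derivWithin_le_of_le_one_div_alphaChar {t : ℝ} (hψt : 0 < ψ t)
    (hψ_anti : AntitoneOn ψ (Ioi t)) (h : K ≤ 1 / alphaChar ψ t) :
    t * derivWithin ψ (Ioi t) t ≤ -(K * ψ t) := by
  rw [alphaChar, one_div_div, le_div_iff₀ hψt, abs_of_nonpos hψ_anti.derivWithin_nonpos] at h
  linarith

/-- Between jumps `ψ(t) t ^ β` has a negative right derivative, and at its jumps it can only go
down; hence no continuity of `ψ` is required. -/
theorem antitoneOn_mul_rpow_of_le_one_div_alphaChar (hψ_pos : ∀ t, 1 ≤ t → 0 < ψ t)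
    (hψ_anti : AntitoneOn ψ (Ici 1)) (hK : 0 < K) (hβK : β < K)
    (hα : ∀ t, t₀ < t → K ≤ 1 / alphaChar ψ t) :
    AntitoneOn (fun t => ψ t * t ^ β) (Ici 1 ∩ Ioi t₀) := by
  rintro a ⟨ha : 1 ≤ a, ha₀ : t₀ < a⟩ b - hab
  have hanti : AntitoneOn ψ (Icc a b) := hψ_anti.mono fun x hx => ha.trans hx.1
  have hdiff : ∀ x ∈ Icc a b, DifferentiableWithinAt ℝ ψ (Ioi x) x := fun x hx =>
    differentiableWithinAt_of_le_one_div_alphaChar hK (hα x (ha₀.trans_le hx.1))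
  refine le_left_of_lowerSemicontinuousOn_of_frequently_le (f := fun t => ψ t * t ^ β) hab
    (fun x hx => ?_) fun x hx => ?_
  · have hx0 : 0 < x := by linarith [hx.1]
    exact lowerSemicontinuousWithinAt_mul_rpow hx0 (fun y hy => by simp; linarith [hy.1]) hanti hx
      (hdiff x hx).continuousWithinAt
  · have hx1 : 1 ≤ x := ha.trans hx.1
    have hψx := hψ_pos x hx1
    have hderiv := mul_derivWithin_le_of_le_one_div_alphaChar hψx
      (hψ_anti.mono fun y (hy : x < y) => hx1.trans hy.le) (hα x (ha₀.trans_le hx.1))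
    have hlt := eventually_mul_rpow_lt_of_hasDerivWithinAt (β := β) (by linarith)
      (hdiff x (Ico_subset_Icc_self hx)).hasDerivWithinAt (hderiv.trans_lt (by gcongr))
    exact (hlt.mono fun y hy => hy.le).frequently

theorem hasPowerDecay_of_antitoneOn_Ici (hψ_nonneg : ∀ t, 1 ≤ t → 0 ≤ ψ t)
    (hψ_anti : AntitoneOn ψ (Ici 1)) (hβ : 0 ≤ β) {t₁ : ℝ} (ht₁ : 1 ≤ t₁)
    (hanti : AntitoneOn (fun t => ψ t * t ^ β) (Ici t₁)) : HasPowerDecay ψ β := by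
  refine ⟨t₁ ^ β, by positivity, fun t s ht hts => ?_⟩
  have hψt := hψ_nonneg t ht
  have hfirst : ∀ u ∈ Icc t t₁, ψ u * u ^ β ≤ t₁ ^ β * (ψ t * t ^ β) := by
    rintro u ⟨htu, hut₁⟩
    have hu : 0 ≤ u := by linarith
    calc ψ u * u ^ β ≤ ψ t * t₁ ^ β := by
          have := hψ_anti ht (ht.trans htu) htu
          gcongr
      _ ≤ t₁ ^ β * (ψ t * t ^ β) := by
          rw [mul_comm]
          gcongr
          exact le_mul_of_one_le_right hψt (Real.one_le_rpow ht hβ)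
  rcases le_total s t₁ with hs | hs
  · exact hfirst s ⟨hts, hs⟩
  rcases le_total t t₁ with ht' | ht'
  · exact (hanti self_mem_Ici hs hs).trans (hfirst t₁ ⟨ht', le_rfl⟩)
  · exact (hanti ht' hs hts).trans
      (le_mul_of_one_le_left (by positivity) (Real.one_le_rpow ht₁ hβ))

theorem hasPowerDecay_of_le_one_div_alphaChar (hψ_pos : ∀ t, 1 ≤ t → 0 < ψ t)
    (hψ_anti : AntitoneOn ψ (Ici 1)) (hβ : 0 ≤ β) (hβK : β < K)
    (hα : ∀ t, t₀ < t → K ≤ 1 / alphaChar ψ t) : HasPowerDecay ψ β := by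
  refine hasPowerDecay_of_antitoneOn_Ici (t₁ := max 1 (t₀ + 1)) (fun t ht => (hψ_pos t ht).le)
    hψ_anti hβ (le_max_left _ _) ?_
  refine (antitoneOn_mul_rpow_of_le_one_div_alphaChar hψ_pos hψ_anti (hβ.trans_lt hβK) hβK
    hα).mono fun t ht => ?_
  rw [mem_Ici, max_le_iff] at ht
  exact ⟨ht.1, lt_of_lt_of_le (lt_add_one t₀) ht.2⟩

end Weight

section PolynomialGrowth

variable {ι : Type*} {ν : ι → ℝ} {ψ : ℝ → ℝ} {β δ t : ℝ}

/-- The sizes `ν k ≥ 1` have polynomial growth of exponent `δ`: up to constant factors, there are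
`t ^ δ` indices of size at most `t`. For frequencies in `ℤ^d` the exponent is `d`. -/
structure HasPolynomialGrowth (ν : ι → ℝ) (δ : ℝ) : Prop where
  exponent_pos : 0 < δ
  one_le : ∀ k, 1 ≤ ν k
  finite : ∀ t, {k | ν k ≤ t}.Finite
  ncard_le : ∃ B > 0, ∀ t > 0, ({k | ν k ≤ t}.ncard : ℝ) ≤ B * t ^ δ
  le_ncard : ∃ b > 0, ∀ t ≥ 1, b * t ^ δ ≤ {k | ν k ≤ t}.ncard

theorem HasPolynomialGrowth.one_le_rpow (hν : HasPolynomialGrowth ν δ) {n : ℕ} (hn : 1 ≤ n) :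
    1 ≤ (n : ℝ) ^ (1 / δ) :=
  Real.one_le_rpow (by exact_mod_cast hn) (one_div_pos.2 hν.exponent_pos).le

theorem HasPolynomialGrowth.exists_finset_two_mul_card_le (hν : HasPolynomialGrowth ν δ) :
    ∃ L, ∀ n : ℕ, 1 ≤ n → ∃ A : Finset ι, 2 * A.card ≤ n ∧
      ∀ k ∉ A, (n : ℝ) ^ (1 / δ) ≤ L * ν k := by
  obtain ⟨B, hB, hcard⟩ := hν.ncard_le
  have hδ := hν.exponent_pos
  set ε : ℝ := (2 * B)⁻¹ ^ (1 / δ)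
  refine ⟨ε⁻¹, fun n hn => ?_⟩
  have hfin := hν.finite (ε * (n : ℝ) ^ (1 / δ))
  refine ⟨hfin.toFinset, ?_, fun k hk => ?_⟩
  · have : (2 * {k | ν k ≤ ε * (n : ℝ) ^ (1 / δ)}.ncard : ℝ) ≤ n := by
      calc (2 * {k | ν k ≤ ε * (n : ℝ) ^ (1 / δ)}.ncard : ℝ)
          ≤ 2 * (B * (ε * (n : ℝ) ^ (1 / δ)) ^ δ) := by
            gcongr
            exact hcard _ (by positivity)
        _ = n := by
            rw [← Real.mul_rpow (by positivity) (by positivity), ← Real.rpow_mul (by positivity),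
              one_div_mul_cancel hδ.ne', Real.rpow_one]
            field_simp
    rw [← ncard_eq_toFinset_card _ hfin]
    exact_mod_cast this
  · rw [le_inv_mul_iff₀ (by positivity)]
    exact (not_le.1 (by simpa using hk)).le

theorem HasPolynomialGrowth.exists_finset_card_eq (hν : HasPolynomialGrowth ν δ) (m : ℕ) :
    ∃ Λ, ∀ n : ℕ, 1 ≤ n → ∃ N : Finset ι, N.card = m * n ∧
      ∀ k ∈ N, ν k ≤ Λ * (n : ℝ) ^ (1 / δ) := by
  obtain ⟨b, hb, hcard⟩ := hν.le_ncard
  have hδ := hν.exponent_pos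
  set Λ : ℝ := max 1 (m / b) ^ (1 / δ)
  have hΛ : 1 ≤ Λ := Real.one_le_rpow (le_max_left _ _) (by positivity)
  refine ⟨Λ, fun n hn => ?_⟩
  have hx := hν.one_le_rpow hn
  have hfin := hν.finite (Λ * (n : ℝ) ^ (1 / δ))
  have hmn : (m * n : ℝ) ≤ {k | ν k ≤ Λ * (n : ℝ) ^ (1 / δ)}.ncard := by
    calc (m * n : ℝ) = b * (m / b * n) := by field_simp
      _ ≤ b * (max 1 (m / b) * n) := by
          gcongr
          exact le_max_right _ _
      _ = b * (Λ * (n : ℝ) ^ (1 / δ)) ^ δ := by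
          rw [← Real.mul_rpow (by positivity) (by positivity), ← Real.rpow_mul (by positivity),
            one_div_mul_cancel hδ.ne', Real.rpow_one]
      _ ≤ {k | ν k ≤ Λ * (n : ℝ) ^ (1 / δ)}.ncard :=
          hcard _ (one_le_mul_of_one_le_of_one_le hΛ hx)
  rw [ncard_eq_toFinset_card _ hfin] at hmn
  obtain ⟨N, hN, hNcard⟩ := Finset.exists_subset_card_eq (n := m * n) (by exact_mod_cast hmn)
  exact ⟨N, hNcard, fun k hk => by simpa using hN hk⟩

theorem ofReal_rpow_neg_le_tsum_indicator (hβ : 0 ≤ β) (ht : 0 < t) {k : ι} (hk : 0 ≤ ν k) :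
    ENNReal.ofReal ((1 + ν k / t) ^ (-β)) ≤
      ∑' j : ℕ, {l | ν l ≤ 2 ^ (j + 1) * t}.indicator
        (fun _ => ENNReal.ofReal ((2 ^ j) ^ (-β))) k := by
  obtain ⟨j, hj, hj'⟩ : ∃ j : ℕ, 2 ^ j ≤ 1 + ν k / t ∧ 1 + ν k / t < 2 ^ (j + 1) :=
    exists_nat_pow_near (le_add_of_nonneg_right (by positivity)) one_lt_two
  have hmem : ν k ≤ 2 ^ (j + 1) * t := (div_le_iff₀ ht).1 (by linarith)
  refine le_trans ?_ (ENNReal.le_tsum j)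
  rw [indicator_of_mem (show k ∈ {l | ν l ≤ 2 ^ (j + 1) * t} from hmem)]
  exact ENNReal.ofReal_le_ofReal
    (Real.rpow_le_rpow_of_nonpos (by positivity) hj (neg_nonpos.2 hβ))

theorem HasPolynomialGrowth.exists_tsum_rpow_neg_le (hν : HasPolynomialGrowth ν δ) (hβ : δ < β) :
    ∃ C > 0, ∀ t > 0,
      ∑' k, ENNReal.ofReal ((1 + ν k / t) ^ (-β)) ≤ ENNReal.ofReal (C * t ^ δ) := by
  obtain ⟨B, hB, hcard⟩ := hν.ncard_le
  have hδ := hν.exponent_pos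
  set ρ : ℝ := 2 ^ (δ - β)
  have hρ : ρ < 1 := Real.rpow_lt_one_of_one_lt_of_neg one_lt_two (sub_neg.2 hβ)
  refine ⟨B * 2 ^ δ * (1 - ρ)⁻¹, mul_pos (by positivity) (inv_pos.2 (sub_pos.2 hρ)),
    fun t ht => ?_⟩
  have hshell (j : ℕ) : ({k | ν k ≤ 2 ^ (j + 1) * t}.ncard : ℝ) * (2 ^ j) ^ (-β) ≤
      B * 2 ^ δ * t ^ δ * ρ ^ j := by
    calc ({k | ν k ≤ 2 ^ (j + 1) * t}.ncard : ℝ) * (2 ^ j) ^ (-β)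
        ≤ B * (2 ^ (j + 1) * t) ^ δ * (2 ^ j) ^ (-β) := by
          gcongr
          exact hcard _ (by positivity)
      _ = B * 2 ^ δ * t ^ δ * ((2 ^ j) ^ δ * (2 ^ j) ^ (-β)) := by
          rw [pow_succ, Real.mul_rpow (by positivity) ht.le,
            Real.mul_rpow (by positivity) zero_le_two]
          ring
      _ = B * 2 ^ δ * t ^ δ * ρ ^ j := by
          rw [← Real.rpow_add (by positivity), ← sub_eq_add_neg, Real.rpow_pow_comm zero_le_two]
  calc ∑' k, ENNReal.ofReal ((1 + ν k / t) ^ (-β))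
      ≤ ∑' k, ∑' j : ℕ, {l | ν l ≤ 2 ^ (j + 1) * t}.indicator
          (fun _ => ENNReal.ofReal ((2 ^ j) ^ (-β))) k :=
        ENNReal.tsum_le_tsum fun k => ofReal_rpow_neg_le_tsum_indicator (hδ.trans hβ).le ht
          (zero_le_one.trans (hν.one_le k))
    _ = ∑' j : ℕ, ENNReal.ofReal ({k | ν k ≤ 2 ^ (j + 1) * t}.ncard * (2 ^ j) ^ (-β)) := by
        rw [ENNReal.tsum_comm]
        refine tsum_congr fun j => ?_
        rw [← tsum_subtype, ENNReal.tsum_set_const, ← (hν.finite _).cast_ncard_eq,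
          ENNReal.ofReal_mul (Nat.cast_nonneg _), ENNReal.ofReal_natCast, ENat.toENNReal_coe]
    _ ≤ ∑' j : ℕ, ENNReal.ofReal (B * 2 ^ δ * t ^ δ * ρ ^ j) :=
        ENNReal.tsum_le_tsum fun j => ENNReal.ofReal_le_ofReal (hshell j)
    _ = ENNReal.ofReal (B * 2 ^ δ * (1 - ρ)⁻¹ * t ^ δ) := by
        rw [← ENNReal.ofReal_tsum_of_nonneg (fun j => by positivity)
          ((summable_geometric_of_lt_one (by positivity) hρ).mul_left _), tsum_mul_left,
          tsum_geometric_of_lt_one (by positivity) hρ]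
        ring_nf

theorem IsDoublingWeight.exists_finset_weight_le (hψ : IsDoublingWeight ψ)
    (hν : HasPolynomialGrowth ν δ) :
    ∃ C > 0, ∀ n : ℕ, 1 ≤ n → ∃ A : Finset ι, 2 * A.card ≤ n ∧
      ∀ k ∉ A, ψ (ν k) ≤ C * ψ ((n : ℝ) ^ (1 / δ)) := by
  obtain ⟨L, hlarge⟩ := hν.exists_finset_two_mul_card_le
  obtain ⟨C, hC, hdoubling⟩ := hψ.exists_le_mul_of_le_mul L
  refine ⟨C, hC, fun n hn => ?_⟩
  obtain ⟨A, hA, hAlarge⟩ := hlarge n hn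
  exact ⟨A, hA, fun k hk => hdoubling _ _ (hν.one_le k) (hν.one_le_rpow hn) (hAlarge k hk)⟩

theorem IsDoublingWeight.exists_finset_le_weight (hψ : IsDoublingWeight ψ)
    (hν : HasPolynomialGrowth ν δ) (m : ℕ) :
    ∃ C > 0, ∀ n : ℕ, 1 ≤ n → ∃ N : Finset ι, N.card = m * n ∧
      ∀ k ∈ N, ψ ((n : ℝ) ^ (1 / δ)) ≤ C * ψ (ν k) := by
  obtain ⟨Λ, hsmall⟩ := hν.exists_finset_card_eq m
  obtain ⟨C, hC, hdoubling⟩ := hψ.exists_le_mul_of_le_mul Λ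
  refine ⟨C, hC, fun n hn => ?_⟩
  obtain ⟨N, hN, hNsmall⟩ := hsmall n hn
  exact ⟨N, hN, fun k hk => hdoubling _ _ (hν.one_le_rpow hn) (hν.one_le k) (hNsmall k hk)⟩

end PolynomialGrowth

section SequenceBounds

variable {ι : Type*} {ν : ι → ℝ} {ψ : ℝ → ℝ} {p q β δ : ℝ}

theorem exists_nTermError_mul_le_of_le (hψ : IsDoublingWeight ψ) (hν : HasPolynomialGrowth ν δ)
    (hq : 0 < q) (hqp : q ≤ p) :
    ∃ K > 0, ∀ n : ℕ, 1 ≤ n → ∀ b : ι → ℝ≥0∞, ∑' k, b k ^ q ≤ 1 →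
      nTermError p n (fun k => b k * ENNReal.ofReal (ψ (ν k))) ≤
        ENNReal.ofReal (K * (ψ ((n : ℝ) ^ (1 / δ)) / (n : ℝ) ^ (1 / q - 1 / p))) := by
  obtain ⟨C, hC, hsmall⟩ := hψ.exists_finset_weight_le hν
  have hexp : 1 / p - 1 / q ≤ 0 := sub_nonpos.2 (one_div_le_one_div_of_le hq hqp)
  refine ⟨C * 2 ^ (1 / q - 1 / p), by positivity, fun n hn b hb => ?_⟩
  obtain ⟨A, hA, hweight⟩ := hsmall n hn
  set x : ℝ := (n : ℝ) ^ (1 / δ)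
  have hψx := hψ.pos x (hν.one_le_rpow hn)
  obtain ⟨m, hm⟩ : ∃ m, A.card + m = n := ⟨n - A.card, by omega⟩
  have hm₀ : (0 : ℝ) < m := by exact_mod_cast (by omega : 0 < m)
  have hnm : (n / 2 : ℝ) ≤ m := by
    rw [div_le_iff₀ two_pos]
    exact_mod_cast (by omega : n ≤ m * 2)
  have hterm : ∀ k, (A : Set ι)ᶜ.indicator (fun k => b k * ENNReal.ofReal (ψ (ν k))) k ≤
      ENNReal.ofReal (C * ψ x) * b k := by
    refine fun k => indicator_apply_le' (fun hk => ?_) fun _ => zero_le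
    rw [mul_comm]
    gcongr
    exact hweight k hk
  calc nTermError p n (fun k => b k * ENNReal.ofReal (ψ (ν k)))
      ≤ ENNReal.ofReal (C * ψ x) * nTermError p m b :=
        (nTermError_le_nTermError_indicator (hq.trans_le hqp) hm.le).trans
          (nTermError_le_mul (hq.trans_le hqp) (ENNReal.ofReal_pos.2 (by positivity)).ne'
            ENNReal.ofReal_ne_top hterm)
    _ ≤ ENNReal.ofReal (C * ψ x) * (m : ℝ≥0∞) ^ (1 / p - 1 / q) := by
        gcongr
        exact nTermError_le_rpow_of_tsum_rpow_le_one hq hqp hb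
    _ = ENNReal.ofReal (C * ψ x * (m : ℝ) ^ (1 / p - 1 / q)) := by
        rw [ENNReal.ofReal_mul (p := C * ψ x) (by positivity), ← ENNReal.ofReal_rpow_of_pos hm₀,
          ENNReal.ofReal_natCast]
    _ ≤ ENNReal.ofReal (C * ψ x * (n / 2 : ℝ) ^ (1 / p - 1 / q)) := by
        gcongr ENNReal.ofReal (_ * ?_)
        exact Real.rpow_le_rpow_of_nonpos (by positivity) hnm hexp
    _ = ENNReal.ofReal (C * 2 ^ (1 / q - 1 / p) * (ψ x / (n : ℝ) ^ (1 / q - 1 / p))) := by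
        rw [← neg_sub (1 / q), Real.rpow_neg (by positivity),
          Real.div_rpow (by positivity) zero_le_two]
        field_simp

theorem exists_tsum_compl_rpow_le (hψ : IsDoublingWeight ψ) (hν : HasPolynomialGrowth ν δ)
    (hβ : HasPowerDecay ψ β) {s : ℝ} (hs : 0 < s) (hδβ : δ < β * s) :
    ∃ K > 0, ∀ n : ℕ, 1 ≤ n → ∃ A : Finset ι, A.card ≤ n ∧
      (∑' k : ((A : Set ι)ᶜ : Set ι), ENNReal.ofReal (ψ (ν k)) ^ s) ^ (1 / s) ≤
        ENNReal.ofReal (K * (ψ ((n : ℝ) ^ (1 / δ)) * (n : ℝ) ^ (1 / s))) := by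
  have hδ := hν.exponent_pos
  have hβ₀ : 0 < β := pos_of_mul_pos_left (hδ.trans hδβ) hs.le
  obtain ⟨L, hsmall⟩ := hν.exists_finset_two_mul_card_le
  obtain ⟨C₁, hC₁, hdecay⟩ := hψ.exists_le_mul_rpow hβ₀.le hβ L
  obtain ⟨C₂, hC₂, hsum⟩ := hν.exists_tsum_rpow_neg_le hδβ
  refine ⟨C₁ * C₂ ^ (1 / s), by positivity, fun n hn => ?_⟩
  obtain ⟨A, hA, hlarge⟩ := hsmall n hn
  set x : ℝ := (n : ℝ) ^ (1 / δ)
  have hx : 1 ≤ x := hν.one_le_rpow hn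
  have hxδ : x ^ δ = n := by
    rw [← Real.rpow_mul (by positivity), one_div_mul_cancel hδ.ne', Real.rpow_one]
  have hψx := hψ.pos x hx
  have hweight : ∀ k ∉ A, ENNReal.ofReal (ψ (ν k)) ^ s ≤
      ENNReal.ofReal ((C₁ * ψ x) ^ s) * ENNReal.ofReal ((1 + ν k / x) ^ (-(β * s))) := by
    intro k hk
    have hνk := hν.one_le k
    have hψk := hψ.pos _ hνk
    rw [ENNReal.ofReal_rpow_of_pos hψk, ← ENNReal.ofReal_mul (by positivity), ← neg_mul,
      Real.rpow_mul (by positivity), ← Real.mul_rpow (by positivity) (by positivity)]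
    gcongr
    exact hdecay x (ν k) hx hνk (hlarge k hk)
  refine ⟨A, by omega, ?_⟩
  calc (∑' k : ((A : Set ι)ᶜ : Set ι), ENNReal.ofReal (ψ (ν k)) ^ s) ^ (1 / s)
      ≤ (ENNReal.ofReal ((C₁ * ψ x) ^ s) * ENNReal.ofReal (C₂ * x ^ δ)) ^ (1 / s) := by
        gcongr
        refine (ENNReal.tsum_le_tsum fun k : ((A : Set ι)ᶜ : Set ι) => hweight k k.2).trans ?_
        rw [ENNReal.tsum_mul_left]
        gcongr
        exact (ENNReal.tsum_comp_le_tsum_of_injective Subtype.val_injective _).trans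
          (hsum x (by positivity))
    _ = ENNReal.ofReal (C₁ * C₂ ^ (1 / s) * (ψ x * (n : ℝ) ^ (1 / s))) := by
        rw [hxδ, ← ENNReal.ofReal_mul (by positivity), ENNReal.ofReal_rpow_of_nonneg
          (by positivity) (by positivity), Real.mul_rpow (by positivity) (by positivity),
          Real.mul_rpow hC₂.le (by positivity), one_div s,
          Real.rpow_rpow_inv (by positivity) hs.ne']
        ring_nf

theorem exists_nTermError_mul_le_of_lt (hψ : IsDoublingWeight ψ) (hν : HasPolynomialGrowth ν δ)
    (hp : 0 < p) (hpq : p < q) (hβ : HasPowerDecay ψ β) (hδβ : δ * (1 / p - 1 / q) < β) :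
    ∃ K > 0, ∀ n : ℕ, 1 ≤ n → ∀ b : ι → ℝ≥0∞, ∑' k, b k ^ q ≤ 1 →
      nTermError p n (fun k => b k * ENNReal.ofReal (ψ (ν k))) ≤
        ENNReal.ofReal (K * (ψ ((n : ℝ) ^ (1 / δ)) / (n : ℝ) ^ (1 / q - 1 / p))) := by
  have hexp : 0 < 1 / p - 1 / q := sub_pos.2 (one_div_lt_one_div_of_lt hp hpq)
  obtain ⟨K, hK, htail⟩ := exists_tsum_compl_rpow_le (s := (1 / p - 1 / q)⁻¹) hψ hν hβ
    (inv_pos.2 hexp) ((lt_mul_inv_iff₀ hexp).2 hδβ)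
  refine ⟨K, hK, fun n hn b hb => ?_⟩
  obtain ⟨A, hA, hAsum⟩ := htail n hn
  rw [← neg_sub (1 / p), Real.rpow_neg (by positivity), div_inv_eq_mul]
  have hexponents : 1 / p = 1 / q + 1 / (1 / p - 1 / q)⁻¹ := by
    rw [one_div (_⁻¹), inv_inv, add_sub_cancel]
  exact (nTermError_mul_le hp hpq hexponents hb hA).trans
    (by simpa only [one_div, inv_inv] using hAsum)

theorem exists_nTermError_mul_le (hψ : IsDoublingWeight ψ) (hν : HasPolynomialGrowth ν δ)
    (hp : 0 < p) (hq : 0 < q)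
    (hdecay : p < q → ∃ β, δ * (1 / p - 1 / q) < β ∧ HasPowerDecay ψ β) :
    ∃ K > 0, ∀ n : ℕ, 1 ≤ n → ∀ b : ι → ℝ≥0∞, ∑' k, b k ^ q ≤ 1 →
      nTermError p n (fun k => b k * ENNReal.ofReal (ψ (ν k))) ≤
        ENNReal.ofReal (K * (ψ ((n : ℝ) ^ (1 / δ)) / (n : ℝ) ^ (1 / q - 1 / p))) := by
  rcases le_or_gt q p with hqp | hpq
  · exact exists_nTermError_mul_le_of_le hψ hν hq hqp
  · obtain ⟨β, hδβ, hβ⟩ := hdecay hpq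
    exact exists_nTermError_mul_le_of_lt hψ hν hp hpq hβ hδβ

theorem sum_rpow_le_one_of_le_card_rpow (hq : 0 < q) {N : Finset ι} {c : ι → ℝ≥0∞}
    (hc : ∀ k ∈ N, c k ≤ (N.card : ℝ≥0∞) ^ (-(1 / q))) : ∑ k ∈ N, c k ^ q ≤ 1 := by
  have hterm : ∀ k ∈ N, c k ^ q ≤ (N.card : ℝ≥0∞)⁻¹ := fun k hk => by
    calc c k ^ q ≤ ((N.card : ℝ≥0∞) ^ (-(1 / q))) ^ q := by
          gcongr
          exact hc k hk
      _ = (N.card : ℝ≥0∞)⁻¹ := by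
          rw [← ENNReal.rpow_mul, neg_mul, one_div_mul_cancel hq.ne', ENNReal.rpow_neg_one]
  refine (Finset.sum_le_card_nsmul _ _ _ hterm).trans ?_
  rw [nsmul_eq_mul]
  exact ENNReal.mul_inv_le_one _

theorem exists_le_nTermError_indicator (hψ : IsDoublingWeight ψ) (hν : HasPolynomialGrowth ν δ)
    (hp : 0 < p) (hq : 0 < q) :
    ∃ K > 0, ∀ n : ℕ, 1 ≤ n → ∃ (N : Finset ι) (M : ℝ), 0 ≤ M ∧
      ∑ k ∈ N, (ENNReal.ofReal M / ENNReal.ofReal (ψ (ν k))) ^ q ≤ 1 ∧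
      ENNReal.ofReal (K * (ψ ((n : ℝ) ^ (1 / δ)) / (n : ℝ) ^ (1 / q - 1 / p))) ≤
        nTermError p n ((N : Set ι).indicator fun _ => ENNReal.ofReal M) := by
  obtain ⟨C, hC, hlarge⟩ := hψ.exists_finset_le_weight hν 2
  refine ⟨2 ^ (-(1 / q)) * C⁻¹, by positivity, fun n hn => ?_⟩
  obtain ⟨N, hN, hweight⟩ := hlarge n hn
  have hn₀ : (0 : ℝ) < n := by exact_mod_cast hn
  set x : ℝ := (n : ℝ) ^ (1 / δ)
  have hψx := hψ.pos x (hν.one_le_rpow hn)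
  refine ⟨N, (N.card : ℝ) ^ (-(1 / q)) * (C⁻¹ * ψ x), by positivity, ?_, ?_⟩
  · refine sum_rpow_le_one_of_le_card_rpow hq fun k hk => ENNReal.div_le_of_le_mul ?_
    rw [ENNReal.ofReal_mul (by positivity), ← ENNReal.ofReal_rpow_of_pos (by rw [hN]; positivity),
      ENNReal.ofReal_natCast]
    gcongr
    exact (inv_mul_le_iff₀ hC).2 (hweight k hk)
  · calc ENNReal.ofReal (2 ^ (-(1 / q)) * C⁻¹ * (ψ x / (n : ℝ) ^ (1 / q - 1 / p)))
        = ENNReal.ofReal ((n : ℝ) ^ (1 / p) * ((N.card : ℝ) ^ (-(1 / q)) * (C⁻¹ * ψ x))) := by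
          rw [hN, Nat.cast_mul, Nat.cast_two, Real.mul_rpow zero_le_two hn₀.le,
            div_eq_mul_inv (ψ x),
            ← Real.rpow_neg hn₀.le, neg_sub, sub_eq_add_neg, Real.rpow_add hn₀]
          ring_nf
      _ = ((N.card - n : ℕ) : ℝ≥0∞) ^ (1 / p) *
            ENNReal.ofReal ((N.card : ℝ) ^ (-(1 / q)) * (C⁻¹ * ψ x)) := by
          rw [ENNReal.ofReal_mul (by positivity), ← ENNReal.ofReal_rpow_of_pos hn₀,
            ENNReal.ofReal_natCast, hN, show 2 * n - n = n by omega]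
      _ ≤ nTermError p n _ := mul_le_nTermError hp fun k hk =>
          (indicator_of_mem (Finset.mem_coe.2 hk) fun _ => _).ge

end SequenceBounds

section Fourier

variable {d : ℕ} {p : ℝ} {n : ℕ} {f : (Fin d → ℝ) → ℂ}

theorem continuous_trigExp (k : Fin d → ℤ) : Continuous (trigExp k) := by
  unfold trigExp
  fun_prop

theorem trigExp_eq_prod (k : Fin d → ℤ) (x : Fin d → ℝ) :
    trigExp k x = ∏ j, Complex.exp (Complex.I * (k j : ℂ) * (x j : ℂ)) := by
  rw [trigExp, ← Complex.exp_sum]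
  push_cast
  rw [Finset.mul_sum]
  simp only [mul_assoc]

theorem trigExp_mul (k l : Fin d → ℤ) (x : Fin d → ℝ) :
    trigExp k x * trigExp l x = trigExp (k + l) x := by
  simp only [trigExp, ← Complex.exp_add, Pi.add_apply, ← mul_add]
  push_cast
  simp only [add_mul, Finset.sum_add_distrib]

theorem trigExp_periodic (k : Fin d → ℤ) (j : Fin d) (x : Fin d → ℝ) :
    trigExp k (x + Pi.single j (2 * Real.pi)) = trigExp k x := by
  have hphase : ∑ i, (k i : ℝ) * (x + Pi.single j (2 * Real.pi) : Fin d → ℝ) i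
      = ∑ i, (k i : ℝ) * x i + (k j : ℝ) * (2 * Real.pi) := by
    simp only [Pi.add_apply, mul_add, Finset.sum_add_distrib]
    simp [Pi.single_apply]
  rw [trigExp, trigExp, hphase, Complex.exp_eq_exp_iff_exists_int]
  exact ⟨k j, by push_cast; ring⟩

theorem integrableOn_trigExp (k : Fin d → ℤ) : IntegrableOn (trigExp k) (torusBox d) volume :=
  (continuous_trigExp k).continuousOn.integrableOn_compact isCompact_Icc

theorem norm_trigExp (k : Fin d → ℤ) (x : Fin d → ℝ) : ‖trigExp k x‖ = 1 := by
  rw [trigExp, mul_comm, Complex.norm_exp_ofReal_mul_I]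

theorem integrableOn_mul_trigExp (hf : IntegrableOn f (torusBox d) volume)
    (k : Fin d → ℤ) : IntegrableOn (fun x => f x * trigExp k x) (torusBox d) volume :=
  Integrable.mul_bdd (c := 1) hf (continuous_trigExp k).aestronglyMeasurable
    (ae_of_all _ fun x => (norm_trigExp k x).le)

theorem integral_exp_int (m : ℤ) :
    ∫ x in Icc (0 : ℝ) (2 * Real.pi), Complex.exp (Complex.I * (m : ℂ) * (x : ℂ))
      = if m = 0 then 2 * (Real.pi : ℂ) else 0 := by
  rw [integral_Icc_eq_integral_Ioc,
    ← intervalIntegral.integral_of_le (by positivity : (0 : ℝ) ≤ 2 * Real.pi)]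
  split_ifs with h
  · simp [h]
  · have hm : Complex.I * (m : ℂ) ≠ 0 := by simp [h]
    rw [integral_exp_mul_complex hm]
    have hperiod : Complex.exp (Complex.I * (m : ℂ) * ((2 * Real.pi : ℝ) : ℂ)) = 1 :=
      Complex.exp_eq_one_iff.2 ⟨m, by push_cast; ring⟩
    rw [hperiod]
    simp

theorem integral_trigExp (k : Fin d → ℤ) :
    ∫ x in torusBox d, trigExp k x = if k = 0 then (2 * (Real.pi : ℂ)) ^ d else 0 := by
  have hbox : torusBox d = Set.univ.pi fun _ => Icc (0 : ℝ) (2 * Real.pi) := by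
    rw [torusBox, ← Set.pi_univ_Icc]
  rw [hbox, volume_pi, Measure.restrict_pi_pi]
  simp only [trigExp_eq_prod]
  rw [integral_fintype_prod_eq_prod (𝕜 := ℂ)
    (f := fun j (t : ℝ) => Complex.exp (Complex.I * (k j : ℂ) * (t : ℂ)))]
  simp only [integral_exp_int]
  split_ifs with h
  · simp [h]
  · obtain ⟨j, hj⟩ := Function.ne_iff.1 h
    exact Finset.prod_eq_zero (Finset.mem_univ j) (if_neg hj)

theorem fourierCoef_trigExp (k l : Fin d → ℤ) :
    fourierCoef (trigExp k) l = if l = k then 1 else 0 := by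
  have hpi : (2 * (Real.pi : ℂ)) ^ d ≠ 0 := by simp [Real.pi_ne_zero]
  simp only [fourierCoef, trigExp_mul, integral_trigExp, ← sub_eq_add_neg, sub_eq_zero]
  by_cases h : l = k
  · simp only [h, if_true]
    exact inv_mul_cancel₀ hpi
  · rw [if_neg (Ne.symm h), if_neg h, mul_zero]

theorem memL1_trigPoly (γ : Finset (Fin d → ℤ)) (c : (Fin d → ℤ) → ℂ) :
    MemL1 (fun x => ∑ k ∈ γ, c k * trigExp k x) where
  periodic j x := by simp only [trigExp_periodic]
  integrableOn := integrable_finsetSum _ fun k _ => (integrableOn_trigExp k).const_mul (c k)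

theorem fourierCoef_sub {g : (Fin d → ℝ) → ℂ} (hf : IntegrableOn f (torusBox d) volume)
    (hg : IntegrableOn g (torusBox d) volume) (l : Fin d → ℤ) :
    fourierCoef (fun x => f x - g x) l = fourierCoef f l - fourierCoef g l := by
  simp only [fourierCoef, sub_mul]
  rw [integral_sub (integrableOn_mul_trigExp hf _) (integrableOn_mul_trigExp hg _), mul_sub]

theorem fourierCoef_trigPoly (γ : Finset (Fin d → ℤ)) (c : (Fin d → ℤ) → ℂ) (l : Fin d → ℤ) :
    fourierCoef (fun x => ∑ k ∈ γ, c k * trigExp k x) l = if l ∈ γ then c l else 0 := by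
  have hterm : ∀ k, ((2 * (Real.pi : ℂ)) ^ d)⁻¹ *
      ∫ x in torusBox d, c k * trigExp k x * trigExp (-l) x = c k * if l = k then 1 else 0 := by
    intro k
    simp only [mul_assoc]
    rw [integral_const_mul, mul_left_comm, ← fourierCoef_trigExp, fourierCoef]
  simp only [fourierCoef, Finset.sum_mul]
  rw [integral_finsetSum _ fun k _ =>
    integrableOn_mul_trigExp ((integrableOn_trigExp k).const_mul (c k)) _, Finset.mul_sum]
  simp only [hterm, mul_ite, mul_one, mul_zero, Finset.sum_ite_eq]

theorem fourierCoef_sub_trigPoly (hf : MemL1 f)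
    (γ : Finset (Fin d → ℤ)) (c : (Fin d → ℤ) → ℂ) (l : Fin d → ℤ) :
    fourierCoef (fun x => f x - ∑ k ∈ γ, c k * trigExp k x) l
      = fourierCoef f l - if l ∈ γ then c l else 0 := by
  rw [fourierCoef_sub hf.integrableOn (memL1_trigPoly γ c).integrableOn, fourierCoef_trigPoly]

theorem sNorm_sub_trigPoly_fourierCoef (hp : 0 < p) (hf : MemL1 f) (γ : Finset (Fin d → ℤ)) :
    sNorm p (fun x => f x - ∑ k ∈ γ, fourierCoef f k * trigExp k x) =
      (∑' k : ((γ : Set (Fin d → ℤ))ᶜ : Set (Fin d → ℤ)), ‖fourierCoef f k‖ₑ ^ p) ^ (1 / p) := by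
  rw [sNorm, seqNorm, tsum_subtype _ fun k => ‖fourierCoef f k‖ₑ ^ p]
  congr 1
  refine tsum_congr fun k => ?_
  rw [fourierCoef_sub_trigPoly hf]
  by_cases hk : k ∈ γ
  · simp [hk, hp]
  · simp [hk]

theorem le_sNorm_sub_trigPoly (hp : 0 < p) (hf : MemL1 f) (γ : Finset (Fin d → ℤ))
    (c : (Fin d → ℤ) → ℂ) :
    (∑' k : ((γ : Set (Fin d → ℤ))ᶜ : Set (Fin d → ℤ)), ‖fourierCoef f k‖ₑ ^ p) ^ (1 / p) ≤
      sNorm p (fun x => f x - ∑ k ∈ γ, c k * trigExp k x) := by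
  refine ENNReal.rpow_le_rpow ?_ (by positivity)
  refine le_trans (ENNReal.tsum_le_tsum fun k => ?_)
    (ENNReal.tsum_comp_le_tsum_of_injective Subtype.val_injective _)
  rw [fourierCoef_sub_trigPoly hf, if_neg (fun hk => k.2 (Finset.mem_coe.2 hk)), sub_zero]

theorem bestNTerm_eq_nTermError (hd : 1 ≤ d) (hp : 0 < p) (hf : MemL1 f) :
    bestNTerm p n f = nTermError p n fun k => ‖fourierCoef f k‖ₑ := by
  have : Nonempty (Fin d) := ⟨⟨0, hd⟩⟩
  refine le_antisymm (le_iInf₂ fun A hA => ?_) (le_iInf₂ fun γ hγ => le_iInf fun c => ?_)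
  · obtain ⟨γ, hAγ, hγ⟩ := Infinite.exists_superset_card_eq A n hA
    refine (iInf₂_le γ hγ).trans ((iInf_le _ (fourierCoef f)).trans ?_)
    rw [sNorm_sub_trigPoly_fourierCoef hp hf]
    gcongr
    exact ENNReal.tsum_mono_subtype (fun k => ‖fourierCoef f k‖ₑ ^ p)
      (compl_subset_compl.2 (Finset.coe_subset.2 hAγ))
  · exact (nTermError_le hγ.le).trans (le_sNorm_sub_trigPoly hp hf γ c)

end Fourier

section Lattice

variable {d : ℕ} {r : ℝ≥0∞} {q t : ℝ} {ψ : ℝ → ℝ} {f : (Fin d → ℝ) → ℂ}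

theorem vecNorm_top (k : Fin d → ℤ) : vecNorm ∞ k = ‖k‖ := by
  rw [vecNorm, PiLp.norm_toLp]
  simp only [Pi.norm_def]
  rfl

theorem vecNorm_eq_sum (hr : 0 < r) (hr' : r ≠ ∞) (k : Fin d → ℤ) :
    vecNorm r k = (∑ j, ‖k j‖ ^ r.toReal) ^ (1 / r.toReal) :=
  PiLp.norm_eq_sum (ENNReal.toReal_pos hr.ne' hr') _

theorem vecNorm_nonneg (r : ℝ≥0∞) (k : Fin d → ℤ) : 0 ≤ vecNorm r k := by
  rcases eq_or_ne r 0 with rfl | hr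
  · simp [vecNorm, PiLp.norm_eq_card]
  rcases eq_or_ne r ∞ with rfl | hr'
  · exact vecNorm_top k ▸ norm_nonneg k
  · rw [vecNorm_eq_sum (pos_iff_ne_zero.2 hr) hr']
    positivity

theorem norm_le_vecNorm (hr : 0 < r) (k : Fin d → ℤ) : ‖k‖ ≤ vecNorm r k := by
  rcases eq_or_ne r ∞ with rfl | hr'
  · exact (vecNorm_top k).ge
  have hr₀ := ENNReal.toReal_pos hr.ne' hr'
  refine (pi_norm_le_iff_of_nonneg (vecNorm_nonneg r k)).2 fun j => ?_
  rw [vecNorm_eq_sum hr hr', one_div,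
    Real.le_rpow_inv_iff_of_pos (norm_nonneg (k j)) (by positivity) hr₀]
  exact Finset.single_le_sum (f := fun j => ‖k j‖ ^ r.toReal) (fun i _ => by positivity)
    (Finset.mem_univ j)

/-- For `r = ∞` the factor is `d ^ 0 = 1`, because `∞.toReal = 0` and `1 / 0 = 0`. -/
theorem vecNorm_le_mul_norm (hr : 0 < r) (k : Fin d → ℤ) :
    vecNorm r k ≤ (d : ℝ) ^ (1 / r.toReal) * ‖k‖ := by
  rcases eq_or_ne r ∞ with rfl | hr'
  · simp [vecNorm_top]
  have hr₀ := ENNReal.toReal_pos hr.ne' hr'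
  rw [vecNorm_eq_sum hr hr', one_div, Real.rpow_inv_le_iff_of_pos (by positivity) (by positivity)
    hr₀, Real.mul_rpow (by positivity) (by positivity), Real.rpow_inv_rpow (by positivity) hr₀.ne']
  calc ∑ j, ‖k j‖ ^ r.toReal ≤ ∑ _j : Fin d, ‖k‖ ^ r.toReal := by
        gcongr with j
        exact norm_le_pi_norm k j
    _ = d * ‖k‖ ^ r.toReal := by simp

theorem one_le_norm_of_ne_zero {k : Fin d → ℤ} (hk : k ≠ 0) : 1 ≤ ‖k‖ := by
  obtain ⟨j, hj⟩ := Function.ne_iff.1 hk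
  refine le_trans ?_ (norm_le_pi_norm k j)
  rw [Int.norm_eq_abs]
  exact_mod_cast Int.one_le_abs hj

/-- The size `|k|_r` of a frequency, raised to `1` at `k = 0`: this turns the convention
`ψ(0) := ψ(1)` into plain evaluation of `ψ`. -/
noncomputable def freqSize (r : ℝ≥0∞) (k : Fin d → ℤ) : ℝ :=
  max 1 (vecNorm r k)

theorem extendZero_vecNorm (hr : 0 < r) (ψ : ℝ → ℝ) (k : Fin d → ℤ) :
    extendZero ψ (vecNorm r k) = ψ (freqSize r k) := by
  rcases eq_or_ne k 0 with rfl | hk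
  · have hzero : vecNorm r (0 : Fin d → ℤ) = 0 :=
      le_antisymm (by simpa using vecNorm_le_mul_norm hr (0 : Fin d → ℤ))
        ((norm_nonneg _).trans (norm_le_vecNorm hr 0))
    rw [freqSize, hzero, extendZero, if_pos rfl, max_eq_left zero_le_one]
  · have hone : 1 ≤ vecNorm r k := (one_le_norm_of_ne_zero hk).trans (norm_le_vecNorm hr k)
    rw [freqSize, extendZero, if_neg (by linarith), max_eq_right hone]

theorem setOf_norm_le_eq_piFinset (ht : 0 ≤ t) :
    {k : Fin d → ℤ | ‖k‖ ≤ t} =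
      Fintype.piFinset fun _ : Fin d => Finset.Icc (-(⌊t⌋₊ : ℤ)) ⌊t⌋₊ := by
  ext k
  simp only [mem_ofPred_eq, Finset.mem_coe, Fintype.mem_piFinset, Finset.mem_Icc, ← abs_le,
    pi_norm_le_iff_of_nonneg ht, Int.norm_eq_abs, Int.natCast_floor_eq_floor ht]
  simp only [Int.le_floor, Int.cast_abs]

theorem ncard_setOf_norm_le (ht : 0 ≤ t) :
    {k : Fin d → ℤ | ‖k‖ ≤ t}.ncard = (2 * ⌊t⌋₊ + 1) ^ d := by
  rw [setOf_norm_le_eq_piFinset ht, ncard_coe_finset, Fintype.card_piFinset_const, Int.card_Icc]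
  congr 1
  omega

theorem finite_setOf_norm_le (t : ℝ) : {k : Fin d → ℤ | ‖k‖ ≤ t}.Finite :=
  (isCompact_closedBall (0 : Fin d → ℤ) t).finite_of_discrete.subset fun _ hk =>
    mem_closedBall_zero_iff.2 hk

theorem setOf_freqSize_le_subset (hr : 0 < r) (t : ℝ) :
    {k : Fin d → ℤ | freqSize r k ≤ t} ⊆ {k | ‖k‖ ≤ t} := fun k hk =>
  (norm_le_vecNorm hr k).trans ((le_max_right _ _).trans hk)

theorem ncard_setOf_freqSize_le (hr : 0 < r) (ht : 0 < t) :
    ({k : Fin d → ℤ | freqSize r k ≤ t}.ncard : ℝ) ≤ 3 ^ d * t ^ d := by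
  rcases lt_or_ge t 1 with ht1 | ht1
  · have hempty : {k : Fin d → ℤ | freqSize r k ≤ t} = ∅ :=
      eq_empty_of_forall_notMem fun k hk => (ht1.trans_le (le_max_left _ _)).not_ge hk
    rw [hempty, ncard_empty, Nat.cast_zero]
    positivity
  · calc ({k : Fin d → ℤ | freqSize r k ≤ t}.ncard : ℝ)
        ≤ ((2 * ⌊t⌋₊ + 1) ^ d : ℕ) := by
          rw [← ncard_setOf_norm_le ht.le]
          exact_mod_cast ncard_le_ncard (setOf_freqSize_le_subset hr t) (finite_setOf_norm_le t)
      _ ≤ 3 ^ d * t ^ d := by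
          push_cast
          rw [← mul_pow]
          gcongr
          linarith [Nat.floor_le ht.le]

theorem exists_mul_pow_le_ncard_setOf_freqSize_le (hd : 1 ≤ d) (hr : 0 < r) :
    ∃ b > 0, ∀ t ≥ 1, b * t ^ d ≤ ({k : Fin d → ℤ | freqSize r k ≤ t}.ncard : ℝ) := by
  set Λ : ℝ := (d : ℝ) ^ (1 / r.toReal)
  have hΛ : 0 < Λ := Real.rpow_pos_of_pos (by exact_mod_cast hd) _
  refine ⟨(Λ ^ d)⁻¹, by positivity, fun t ht => ?_⟩
  have hsubset : {k : Fin d → ℤ | ‖k‖ ≤ t / Λ} ⊆ {k | freqSize r k ≤ t} := fun k hk =>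
    max_le ht ((vecNorm_le_mul_norm hr k).trans ((le_div_iff₀' hΛ).1 hk))
  calc (Λ ^ d)⁻¹ * t ^ d = (t / Λ) ^ d := by rw [div_pow, inv_mul_eq_div]
    _ ≤ ((2 * ⌊t / Λ⌋₊ + 1) ^ d : ℕ) := by
        push_cast
        gcongr
        linarith [Nat.lt_floor_add_one (t / Λ), (⌊t / Λ⌋₊.cast_nonneg : (0 : ℝ) ≤ _)]
    _ ≤ {k : Fin d → ℤ | freqSize r k ≤ t}.ncard := by
        rw [← ncard_setOf_norm_le (by positivity)]
        exact_mod_cast ncard_le_ncard hsubset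
          ((finite_setOf_norm_le t).subset (setOf_freqSize_le_subset hr t))

theorem hasPolynomialGrowth_freqSize (hd : 1 ≤ d) (hr : 0 < r) :
    HasPolynomialGrowth (freqSize r : (Fin d → ℤ) → ℝ) d where
  exponent_pos := by exact_mod_cast hd
  one_le _ := le_max_left _ _
  finite t := (finite_setOf_norm_le t).subset (setOf_freqSize_le_subset hr t)
  ncard_le := ⟨3 ^ d, by positivity, fun t ht => by
    rw [Real.rpow_natCast]
    exact ncard_setOf_freqSize_le hr ht⟩
  le_ncard := by
    simpa only [Real.rpow_natCast] using exists_mul_pow_le_ncard_setOf_freqSize_le hd hr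

theorem mem_classF_iff (hr : 0 < r) (hq : 0 < q) (hψ : ∀ t, 1 ≤ t → 0 < ψ t) :
    f ∈ classF d q r ψ ↔ MemL1 f ∧
      ∑' k, (‖fourierCoef f k‖ₑ / ENNReal.ofReal (ψ (freqSize r k))) ^ q ≤ 1 := by
  have henorm : ∀ k, ‖fourierCoef f k / (extendZero ψ (vecNorm r k) : ℂ)‖ₑ =
      ‖fourierCoef f k‖ₑ / ENNReal.ofReal (ψ (freqSize r k)) := fun k => by
    have hψk := hψ (freqSize r k) (le_max_left _ _)
    rw [extendZero_vecNorm hr, div_eq_mul_inv, enorm_mul,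
      enorm_inv (by exact_mod_cast hψk.ne'), ← ofReal_norm (ψ _ : ℂ), Complex.norm_of_nonneg hψk.le,
      div_eq_mul_inv]
  refine and_congr_right' ?_
  rw [seqNorm, one_div, ENNReal.rpow_inv_le_iff hq, ENNReal.one_rpow]
  simp only [henorm]

end Lattice

section Class

variable {d : ℕ} {p q : ℝ} {r : ℝ≥0∞} {ψ : ℝ → ℝ}

theorem exists_bestNTermClass_le (hd : 1 ≤ d) (hp : 0 < p) (hq : 0 < q)
    (hψ : IsDoublingWeight ψ)
    (hdecay : p < q → ∃ β, (d : ℝ) * (1 / p - 1 / q) < β ∧ HasPowerDecay ψ β) (hr : 0 < r) :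
    ∃ K > 0, ∀ n : ℕ, 1 ≤ n → bestNTermClass p n (classF d q r ψ) ≤
      ENNReal.ofReal (K * (ψ ((n : ℝ) ^ (1 / (d : ℝ))) / (n : ℝ) ^ (1 / q - 1 / p))) := by
  obtain ⟨K, hK, hbound⟩ :=
    exists_nTermError_mul_le hψ (hasPolynomialGrowth_freqSize hd hr) hp hq hdecay
  refine ⟨K, hK, fun n hn => iSup₂_le fun f hf => ?_⟩
  obtain ⟨hfL1, hsum⟩ := (mem_classF_iff hr hq hψ.pos).1 hf
  rw [bestNTerm_eq_nTermError hd hp hfL1]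
  have hcancel : ∀ k, ‖fourierCoef f k‖ₑ / ENNReal.ofReal (ψ (freqSize r k)) *
      ENNReal.ofReal (ψ (freqSize r k)) = ‖fourierCoef f k‖ₑ := fun k =>
    ENNReal.div_mul_cancel (ENNReal.ofReal_pos.2 (hψ.pos _ (le_max_left _ _))).ne'
      ENNReal.ofReal_ne_top
  simpa only [hcancel] using hbound n hn _ hsum

theorem exists_le_bestNTermClass (hd : 1 ≤ d) (hp : 0 < p) (hq : 0 < q)
    (hψ : IsDoublingWeight ψ) (hr : 0 < r) :
    ∃ K > 0, ∀ n : ℕ, 1 ≤ n →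
      ENNReal.ofReal (K * (ψ ((n : ℝ) ^ (1 / (d : ℝ))) / (n : ℝ) ^ (1 / q - 1 / p))) ≤
        bestNTermClass p n (classF d q r ψ) := by
  obtain ⟨K, hK, hbound⟩ :=
    exists_le_nTermError_indicator hψ (hasPolynomialGrowth_freqSize hd hr) hp hq
  refine ⟨K, hK, fun n hn => ?_⟩
  obtain ⟨N, M, hM, hsum, herror⟩ := hbound n hn
  set f : (Fin d → ℝ) → ℂ := fun x => ∑ k ∈ N, (M : ℂ) * trigExp k x
  have hf : MemL1 f := memL1_trigPoly N fun _ => (M : ℂ)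
  have hcoef : ∀ k, ‖fourierCoef f k‖ₑ =
      (N : Set (Fin d → ℤ)).indicator (fun _ => ENNReal.ofReal M) k := fun k => by
    rw [fourierCoef_trigPoly N fun _ => (M : ℂ)]
    by_cases hk : k ∈ N
    · simp [hk, ← ofReal_norm, abs_of_nonneg hM]
    · simp [hk]
  have hmem : f ∈ classF d q r ψ := by
    refine (mem_classF_iff hr hq hψ.pos).2 ⟨hf, ?_⟩
    rw [tsum_eq_sum (s := N) fun k hk => by simp [hcoef, hk, hq]]
    refine (Finset.sum_congr rfl fun k hk => ?_).trans_le hsum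
    rw [hcoef, indicator_of_mem (Finset.mem_coe.2 hk)]
  refine herror.trans (le_iSup₂_of_le f hmem ?_)
  rw [bestNTerm_eq_nTermError hd hp hf]
  simp only [hcoef, le_refl]

theorem sameOrder_of_exists_le {a : ℕ → ℝ≥0∞} {b : ℕ → ℝ} (hb : ∀ n, 1 ≤ n → 0 ≤ b n)
    (hlower : ∃ K > 0, ∀ n, 1 ≤ n → ENNReal.ofReal (K * b n) ≤ a n)
    (hupper : ∃ K > 0, ∀ n, 1 ≤ n → a n ≤ ENNReal.ofReal (K * b n)) : SameOrder a b := by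
  obtain ⟨K₁, hK₁, hlower⟩ := hlower
  obtain ⟨K₂, hK₂, hupper⟩ := hupper
  refine ⟨K₁, K₁ + K₂, hK₁, lt_add_of_pos_right K₁ hK₂, fun n hn => ⟨hlower n hn, ?_⟩⟩
  refine (hupper n hn).trans (ENNReal.ofReal_le_ofReal ?_)
  exact mul_le_mul_of_nonneg_right (le_add_of_nonneg_left hK₁.le) (hb n hn)

end Class

end TrigApprox

theorem corollary4p1_general {d : ℕ} (hd : 1 ≤ d) {p q : ℝ} (hp : 0 < p) (hq : 0 < q)
    {ψ : ℝ → ℝ} (hψ : TrigApprox.IsDoublingWeight ψ)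
    (hdecay : p < q → ∃ β, (d : ℝ) * (1 / p - 1 / q) < β ∧ TrigApprox.HasPowerDecay ψ β)
    {r : ℝ≥0∞} (hr : 0 < r) :
    TrigApprox.SameOrder
      (fun n => TrigApprox.bestNTermClass p n (TrigApprox.classF d q r ψ))
      (fun n => ψ ((n : ℝ) ^ (1 / (d : ℝ))) / (n : ℝ) ^ (1 / q - 1 / p)) := by
  refine TrigApprox.sameOrder_of_exists_le (fun n hn => ?_)
    (TrigApprox.exists_le_bestNTermClass hd hp hq hψ hr)
    (TrigApprox.exists_bestNTermClass_le hd hp hq hψ hdecay hr)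
  have hψn := hψ.pos _ (Real.one_le_rpow (by exact_mod_cast hn : (1 : ℝ) ≤ n)
    (by positivity : 0 ≤ 1 / (d : ℝ)))
  positivity

theorem corollary4p1 (d : ℕ) (hd : 1 ≤ d) (p q : ℝ) (hp : 1 ≤ p) (hq : 0 < q)
    (ψ : ℝ → ℝ) (hψ_pos : ∀ t, 1 ≤ t → 0 < ψ t) (hψ_anti : AntitoneOn ψ (Set.Ici 1))
    (hψB : (fun t => ψ t ^ p) ∈ TrigApprox.classB)
    (hψ_conv : p < q → ∃ t₀ : ℝ, ConvexOn ℝ (Set.Ioi t₀) (fun t => ψ t ^ p) ∧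
      ∃ Kψ : ℝ, (d : ℝ) * (1 / p - 1 / q) < Kψ ∧
        ∀ t, t₀ < t → Kψ ≤ 1 / TrigApprox.alphaChar ψ t)
    (r : ℝ≥0∞) (hr : 1 ≤ r) :
    TrigApprox.SameOrder
      (fun n => TrigApprox.bestNTermClass p n (TrigApprox.classF d q r ψ))
      (fun n => ψ ((n : ℝ) ^ (1 / (d : ℝ))) / (n : ℝ) ^ (1 / q - 1 / p)) := by
  have hp₀ : 0 < p := zero_lt_one.trans_le hp
  refine corollary4p1_general hd hp₀ hq
    (TrigApprox.isDoublingWeight_of_rpow_mem_classB hp₀ hψ_pos hψ_anti hψB) (fun hpq => ?_)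
    (zero_lt_one.trans_le hr)
  obtain ⟨t₀, -, Kψ, hKψ, hα⟩ := hψ_conv hpq
  obtain ⟨β, hβ, hβK⟩ := exists_between hKψ
  have hexp : 0 ≤ 1 / p - 1 / q := sub_nonneg.2 (one_div_le_one_div_of_le hp₀ hpq.le)
  exact ⟨β, hβ, TrigApprox.hasPowerDecay_of_le_one_div_alphaChar hψ_pos hψ_anti
    ((by positivity : 0 ≤ (d : ℝ) * (1 / p - 1 / q)).trans hβ.le) hβK hα⟩
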